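/- Let $K$ be a number field of degree $d$ over $\mathbb{Q}$, embedded in a fixed algebraic closure $\overline{\mathbb{Q}}$, let $N \ge 2$ and $M \ge 1$ be integers, and let $F \in K[X_1,\dots,X_N]$ be an inhomogeneous (that is, not homogeneous) polynomial of total degree $M$ which does not vanish at any of the standard basis vectors $e_1,\dots,e_N$. Then there exists $z = (z_1,\dots,z_N) \in \overline{\mathbb{Q}}^N$ with $\deg_K(z) := [K(z_1,\dots,z_N):K] \le M$ such that $F(z) = 0$, $z_i \ne 0$ for all $1 \le i \le N$, and $$H(z) \le C_2(N+1,M)\, H(F)^{1/M},$$ where $$C_2(N,M) = 2^{N-1} \left( \frac{M+2}{2} \right)^{\frac{(4M+1)(N-2)}{2M}} \prod_{j=2}^{N} \binom{M+j-2}{j-2}^{\frac{1}{2M}}.$$ Here, for a number field $L$ of degree $d_L$ over $\mathbb{Q}$ and $x \in L^n$, $$H(x) = \prod_{v \mid \infty} \Big( \sum_{i=1}^n \|x_i\|_v^2 \Big)^{\frac{d_v}{2 d_L}} \prod_{v \nmid \infty} \max_{1 \le i \le n} \|x_i\|_v^{\frac{d_v}{d_L}},$$ the products being over the places $v$ of $L$,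 with $d_v$ the local degree at $v$ and $\|\cdot\|_v$ the absolute value on $L$ that extends the usual absolute value of $\mathbb{Q}$ at the place below $v$; $H(z)$ for $z \in \overline{\mathbb{Q}}^N$ is evaluated over any number field containing the coordinates of $z$ (it does not depend on the choice), and $H(F)$ is the height of the vector of coefficients of $F$. -/

import Mathlib

noncomputable section

/-- A fixed algebraic closure of the field of rational numbers. -/
abbrev Qbar : Type := AlgebraicClosure ℚ

namespace PolyHeight

open NumberField

/-- The local height at an infinite place `v` of a number field `K` of degree `d`:
`(∑ i, ‖x i‖ ^ 2) ^ (d_v / (2 * d))`, where `v.mult` is the local degree `d_v`. -/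
def infiniteLocalHeight {K : Type*} [Field K] [NumberField K] {ι : Type*} [Fintype ι]
    (v : InfinitePlace K) (x : ι → K) : ℝ :=
  (∑ i, v (x i) ^ 2) ^ ((v.mult : ℝ) / (2 * (Module.finrank ℚ K : ℝ)))

/-- The local height at a finite place `v` of a number field `K` of degree `d`: the maximum of
`|x i|_v`, where `|a|_v = ‖a‖_v ^ (d_v / d)` and `‖ ‖_v` extends the usual `p`-adic absolute value.
The absolute value that Mathlib attaches to a finite place is `a ↦ ‖a‖_v ^ d_v`, so that
`|a|_v = (v a) ^ (1 / d)`. -/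
def finiteLocalHeight {K : Type*} [Field K] [NumberField K] {ι : Type*}
    (v : FinitePlace K) (x : ι → K) : ℝ :=
  ⨆ i, (v (x i)) ^ ((1 : ℝ) / (Module.finrank ℚ K : ℝ))

/-- The global height on finite tuples of elements of a number field, with Euclidean norms at the
infinite places and maximum norms at the finite places. -/
def height {K : Type*} [Field K] [NumberField K] {ι : Type*} [Fintype ι] (x : ι → K) : ℝ :=
  (∏ v : InfinitePlace K, infiniteLocalHeight v x) * ∏ᶠ v : FinitePlace K, finiteLocalHeight v x

/-- The height of a polynomial over a number field: the height of its coefficient vector. -/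
def polyHeight {K : Type*} [Field K] [NumberField K] {σ : Type*} (F : MvPolynomial σ K) : ℝ :=
  height fun m : F.support => F.coeff (m : σ →₀ ℕ)

/-- The number field generated over `ℚ` by the coordinates of a point. -/
abbrev coordField {ι : Type*} (x : ι → Qbar) : IntermediateField ℚ Qbar :=
  IntermediateField.adjoin ℚ (Set.range x)

instance coordField_numberField {ι : Type*} [Finite ι] (x : ι → Qbar) :
    NumberField (coordField x) where
  to_charZero := inferInstance
  to_finiteDimensional :=
    IntermediateField.finiteDimensional_adjoin fun y _ => (AlgebraicClosure.isAlgebraic ℚ).isIntegral.isIntegral y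

/-- The absolute height of a point with algebraic coordinates, evaluated over the number field
which its coordinates generate. -/
def absHeight {ι : Type*} [Fintype ι] (x : ι → Qbar) : ℝ :=
  height fun i =>
    (⟨x i, IntermediateField.subset_adjoin ℚ (Set.range x) ⟨i, rfl⟩⟩ : coordField x)

/-- The degree over `K` of a point with algebraic coordinates: `[K(x_1, ..., x_N) : K]`. -/
def degOver (K : Type*) [Field K] [Algebra K Qbar] {ι : Type*} (x : ι → Qbar) : ℕ :=
  Module.finrank K (IntermediateField.adjoin K (Set.range x))

/-- The constant `C_2(N, M)`, for `N ≥ 2` and `M ≥ 1`. -/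
def C2 (N M : ℕ) : ℝ :=
  2 ^ (N - 1) *
    (((M : ℝ) + 2) / 2) ^ (((4 * (M : ℝ) + 1) * ((N : ℝ) - 2)) / (2 * (M : ℝ))) *
    ∏ j ∈ Finset.Icc 2 N, ((Nat.choose (M + j - 2) (j - 2) : ℕ) : ℝ) ^ ((1 : ℝ) / (2 * (M : ℝ)))

end PolyHeight

end

/-! ### Heights of tuples and the product formula -/

section

open NumberField

/-! The height is projective: by the product formula H(t b) = H(b) for t ≠ 0. So a zero z = t b with
b a vector of small positive integers has height at most √N · max b, whatever t is
(`height_mul_natCast_le`). On the line spanned by b, F becomes a one-variable polynomial f of degree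
at most M whose k-th coefficient is F_k(b), F_k being the homogeneous part of degree k. As F is
inhomogeneous, F_M and some F_k with k < M are nonzero; b in {1, ..., 2M}^N can be chosen with
F_M(b) F_k(b) ≠ 0. Then f has two nonzero coefficients, hence a root t ≠ 0, of degree at most M over
K. Finally √N · 2M ≤ C_2(N+1, M) and H(F) ≥ 1. -/

lemma NumberField.FinitePlace.rpow_hasFiniteMulSupport {K : Type*} [Field K] [NumberField K] {x : K}
    (hx : x ≠ 0) (r : ℝ) :
    (fun v : FinitePlace K => v x ^ r).HasFiniteMulSupport := by
  refine (FinitePlace.hasFiniteMulSupport hx).subset fun v hv => ?_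
  simp only [Function.mem_mulSupport] at hv ⊢
  exact fun h1 => hv (by rw [h1, Real.one_rpow])

/-- Scaled form of the product formula. -/
lemma prod_rpow_mul_finprod_rpow_eq_one {K : Type*} [Field K] [NumberField K] {x : K}
    (hx : x ≠ 0) (r : ℝ) :
    (∏ v : InfinitePlace K, v x ^ ((v.mult : ℝ) * r)) * ∏ᶠ v : FinitePlace K, v x ^ r = 1 := by
  have hfin : (Function.mulSupport fun v : FinitePlace K => v x).Finite :=
    FinitePlace.hasFiniteMulSupport hx
  have h := prod_abs_eq_one hx
  have hsub : (Function.mulSupport fun v : FinitePlace K => v x ^ r) ⊆ hfin.toFinset := by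
    intro v hv
    simp only [Set.Finite.coe_toFinset, Function.mem_mulSupport] at hv ⊢
    exact fun h1 => hv (by rw [h1, Real.one_rpow])
  rw [finprod_eq_prod_of_mulSupport_subset (s := hfin.toFinset) _ (by simp)] at h
  rw [finprod_eq_prod_of_mulSupport_subset _ hsub,
    Real.finsetProd_rpow _ _ fun v _ => apply_nonneg v x]
  have hinf : ∀ v : InfinitePlace K, v x ^ ((v.mult : ℝ) * r) = (v x ^ v.mult) ^ r := fun v => by
    rw [Real.rpow_mul (apply_nonneg v x), Real.rpow_natCast]
  simp_rw [hinf]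
  rw [Real.finsetProd_rpow _ _ fun v _ => pow_nonneg (apply_nonneg v x) _,
    ← Real.mul_rpow (Finset.prod_nonneg fun v _ => pow_nonneg (apply_nonneg v x) _)
      (Finset.prod_nonneg fun v _ => apply_nonneg v x), h, Real.one_rpow]

namespace PolyHeight

variable {K : Type*} [Field K] [NumberField K] {ι : Type*}

lemma finiteLocalHeight_hasFiniteMulSupport [Finite ι] [Nonempty ι] {x : ι → K}
    (hx : ∀ i, x i ≠ 0) : (fun v : FinitePlace K => finiteLocalHeight v x).HasFiniteMulSupport := by
  unfold finiteLocalHeight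
  exact .iSup fun i => FinitePlace.rpow_hasFiniteMulSupport (hx i) _

lemma finiteLocalHeight_nonneg (v : FinitePlace K) (x : ι → K) : 0 ≤ finiteLocalHeight v x :=
  Real.iSup_nonneg fun _ => Real.rpow_nonneg (apply_nonneg v _) _

lemma sq_rpow_div {a : ℝ} (ha : 0 ≤ a) (m d : ℝ) :
    (a ^ 2) ^ (m / (2 * d)) = a ^ (m * (1 / d)) := by
  rw [← Real.rpow_natCast, ← Real.rpow_mul ha]
  congr 1
  rw [Nat.cast_ofNat, mul_one_div, mul_div_assoc', mul_div_mul_left _ _ two_ne_zero]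

/-- The height of a tuple of nonzero elements is at least one. -/
lemma one_le_height [Fintype ι] [Nonempty ι] {x : ι → K} (hx : ∀ i, x i ≠ 0) :
    1 ≤ height x := by
  obtain ⟨i⟩ := ‹Nonempty ι›
  -- Write 1 as the product formula for one coordinate and compare place by place.
  rw [← prod_rpow_mul_finprod_rpow_eq_one (hx i) (1 / (Module.finrank ℚ K : ℝ)), height]
  refine mul_le_mul ?_ ?_ (finprod_nonneg fun v => Real.rpow_nonneg (apply_nonneg v _) _)
    (Finset.prod_nonneg fun v _ => Real.rpow_nonneg (by positivity) _)
  · refine Finset.prod_le_prod (fun v _ => Real.rpow_nonneg (apply_nonneg v _) _) fun v _ => ?_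
    rw [← sq_rpow_div (apply_nonneg v _), infiniteLocalHeight]
    refine Real.rpow_le_rpow (sq_nonneg _) ?_ (by positivity)
    exact Finset.single_le_sum (f := fun i => v (x i) ^ 2) (fun j _ => sq_nonneg _)
      (Finset.mem_univ i)
  · have : Nonempty ι := ⟨i⟩
    refine finprod_le_finprod (FinitePlace.rpow_hasFiniteMulSupport (hx i) _)
      (fun v => Real.rpow_nonneg (apply_nonneg v _) _) (finiteLocalHeight_hasFiniteMulSupport hx)
      fun v => ?_
    exact le_ciSup (f := fun i => v (x i) ^ ((1 : ℝ) / (Module.finrank ℚ K : ℝ)))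
      (Set.finite_range _).bddAbove i

lemma one_le_polyHeight {σ : Type*} {F : MvPolynomial σ K} (hF : F ≠ 0) : 1 ≤ polyHeight F := by
  have : Nonempty F.support := (MvPolynomial.support_nonempty.mpr hF).to_subtype
  exact one_le_height fun m => MvPolynomial.mem_support_iff.mp m.2

/-- A nonzero multiple of a tuple of nonzero naturals at most `B` has height at most `√n * B`. -/
lemma height_mul_natCast_le [Fintype ι] [Nonempty ι] {t : K} (ht : t ≠ 0) {b : ι → ℕ} {B : ℕ}
    (hb : ∀ i, b i ≠ 0) (hB : ∀ i, b i ≤ B) :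
    height (fun i => t * (b i : K)) ≤ √(Fintype.card ι) * B := by
  set d : ℝ := (Module.finrank ℚ K : ℝ) with hd
  set A : ℝ := √(Fintype.card ι) * B with hA
  have hd0 : d ≠ 0 := Nat.cast_ne_zero.mpr Module.finrank_pos.ne'
  have hA0 : 0 < A := by
    obtain ⟨i⟩ := ‹Nonempty ι›
    have : 0 < B := (Nat.pos_of_ne_zero (hb i)).trans_le (hB i)
    have : Nonempty ι := ⟨i⟩
    have : 0 < Fintype.card ι := Fintype.card_pos
    positivity
  -- The local degrees at the infinite places sum to d.
  have hprod : ∏ v : InfinitePlace K, A ^ ((v.mult : ℝ) * (1 / d)) = A := by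
    rw [← Real.rpow_sum_of_pos hA0, ← Finset.sum_mul, ← Nat.cast_sum, InfinitePlace.sum_mult_eq,
      ← hd, mul_one_div_cancel hd0, Real.rpow_one]
  calc height (fun i => t * (b i : K))
      ≤ (∏ v : InfinitePlace K, A ^ ((v.mult : ℝ) * (1 / d)) * v t ^ ((v.mult : ℝ) * (1 / d))) *
          ∏ᶠ v : FinitePlace K, v t ^ (1 / d) := ?_
    _ = A := by
      rw [Finset.prod_mul_distrib, hprod, mul_assoc, prod_rpow_mul_finprod_rpow_eq_one ht, mul_one]
  refine mul_le_mul ?_ ?_ (finprod_nonneg fun v => finiteLocalHeight_nonneg v _)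
    (Finset.prod_nonneg fun v _ => mul_nonneg (by positivity)
      (Real.rpow_nonneg (apply_nonneg v _) _))
  · refine Finset.prod_le_prod (fun v _ => Real.rpow_nonneg (by positivity) _) fun v _ => ?_
    rw [← Real.mul_rpow hA0.le (apply_nonneg v _),
      ← sq_rpow_div (mul_nonneg hA0.le (apply_nonneg v _)), infiniteLocalHeight]
    refine Real.rpow_le_rpow (by positivity) ?_ (by positivity)
    calc ∑ i, v (t * (b i : K)) ^ 2 ≤ ∑ _i : ι, (v t * B) ^ 2 := by
          gcongr with i
          rw [map_mul, InfinitePlace.map_natCast]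
          have := apply_nonneg v t
          gcongr
          exact hB i
      _ = (A * v t) ^ 2 := by
          rw [Finset.sum_const, Finset.card_univ, nsmul_eq_mul, hA, mul_pow, mul_pow, mul_pow,
            Real.sq_sqrt (Nat.cast_nonneg _)]
          ring
  · refine finprod_le_finprod (finiteLocalHeight_hasFiniteMulSupport fun i =>
      mul_ne_zero ht (Nat.cast_ne_zero.mpr (hb i))) (fun v => finiteLocalHeight_nonneg v _)
      (FinitePlace.rpow_hasFiniteMulSupport ht _) fun v => ?_
    refine ciSup_le fun i => Real.rpow_le_rpow (apply_nonneg v _) ?_ (by positivity)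
    rw [map_mul]
    -- Integers have absolute value at most 1 at finite places.
    exact mul_le_of_le_one_right (apply_nonneg v _)
      (by
      rw [← FinitePlace.norm_embedding_eq]
      simpa using FinitePlace.norm_le_one K v.maximalIdeal (b i : 𝓞 K))

end PolyHeight

end

/-! ### The numerical constant -/

namespace PolyHeight

/-- The binomials are at least 1, the exponent of (M+2)/2 is at least 2, √N ≤ 2^N, and ((M+2)/2)² ≥
2M because (M-2)² ≥ 0. -/
lemma sqrt_mul_le_C2 {N M : ℕ} (hN : 2 ≤ N) (hM : 1 ≤ M) :
    √(N : ℝ) * (2 * M : ℕ) ≤ C2 (N + 1) M := by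
  have hM' : (1 : ℝ) ≤ M := by exact_mod_cast hM
  have hN' : (2 : ℝ) ≤ N := by exact_mod_cast hN
  have hbinom : 1 ≤ ∏ j ∈ Finset.Icc 2 (N + 1),
      ((Nat.choose (M + j - 2) (j - 2) : ℕ) : ℝ) ^ ((1 : ℝ) / (2 * (M : ℝ))) := by
    refine Finset.prod_induction _ (1 ≤ ·) (fun _ _ => one_le_mul_of_one_le_of_one_le) le_rfl
      fun j hj => Real.one_le_rpow ?_ (by positivity)
    rw [Finset.mem_Icc] at hj
    exact_mod_cast Nat.choose_pos (by omega)
  have hexp : (2 : ℝ) ≤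
      ((4 * (M : ℝ) + 1) * (((N + 1 : ℕ) : ℝ) - 2)) / (2 * (M : ℝ)) := by
    rw [le_div_iff₀ (by positivity)]
    push_cast
    nlinarith
  have hpow : (((M : ℝ) + 2) / 2) ^ 2 ≤ (((M : ℝ) + 2) / 2) ^
      (((4 * (M : ℝ) + 1) * (((N + 1 : ℕ) : ℝ) - 2)) / (2 * (M : ℝ))) := by
    rw [← Real.rpow_natCast]
    exact Real.rpow_le_rpow_of_exponent_le (by linarith) (by exact_mod_cast hexp)
  have hsqrt : √(N : ℝ) ≤ 2 ^ N := by
    have h1 : (N : ℝ) ≤ 2 ^ N := by exact_mod_cast N.lt_two_pow_self.le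
    exact (Real.sqrt_le_iff.mpr ⟨by linarith, by nlinarith⟩).trans h1
  calc √(N : ℝ) * (2 * M : ℕ) ≤ 2 ^ N * (((M : ℝ) + 2) / 2) ^ 2 := by
        gcongr
        push_cast
        nlinarith [sq_nonneg ((M : ℝ) - 2)]
    _ ≤ C2 (N + 1) M := by
        rw [C2, Nat.add_sub_cancel]
        exact (mul_le_mul_of_nonneg_left hpow (by positivity)).trans
          (le_mul_of_one_le_right (by positivity) hbinom)

end PolyHeight

/-! ### Restriction to a line through the origin -/

section

open MvPolynomial

/-- The restriction of a polynomial to the line through the origin spanned by `b`. -/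
lemma coeff_aeval_C_mul_X {R σ : Type*} [CommRing R] (F : MvPolynomial σ R) (b : σ → R) (k : ℕ) :
    (aeval (fun i => Polynomial.C (b i) * Polynomial.X) F).coeff k =
      eval b (homogeneousComponent k F) := by
  induction F using MvPolynomial.induction_on' with
  | monomial m a =>
    have h : (aeval (fun i => Polynomial.C (b i) * Polynomial.X) (monomial m a) :
        Polynomial R) = Polynomial.C (eval b (monomial m a)) * Polynomial.X ^ m.degree := by
      rw [aeval_monomial, eval_monomial]
      simp only [Finsupp.prod, mul_pow, Finset.prod_mul_distrib, Finset.prod_pow_eq_pow_sum,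
        Finsupp.degree_apply, map_mul, map_prod, map_pow, mul_assoc]
      rfl
    rw [h, Polynomial.coeff_C_mul_X_pow,
      homogeneousComponent_of_mem (n := m.degree) (isHomogeneous_monomial a rfl)]
    split_ifs <;> simp
  | add p q hp hq => simp [hp, hq]

/-- A nonzero polynomial has a nonvanishing point with coordinates in `{1, ..., n}`, if `n` exceeds
its total degree. -/
lemma exists_natCast_eval_ne_zero {R σ : Type*} [CommRing R] [IsDomain R] [CharZero R] [Finite σ]
    {P : MvPolynomial σ R} (hP : P ≠ 0) {n : ℕ} (hn : P.totalDegree < n) :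
    ∃ b : σ → ℕ, (∀ i, b i ≠ 0) ∧ (∀ i, b i ≤ n) ∧ eval (fun i => (b i : R)) P ≠ 0 := by
  classical
  by_contra! h
  refine hP (eq_zero_of_eval_zero_at_prod_finset P
    (fun _ => (Finset.Icc 1 n).image (Nat.cast : ℕ → R)) (fun i => ?_) fun x hx => ?_)
  · rw [Finset.card_image_of_injective _ Nat.cast_injective, Nat.card_Icc, Nat.add_sub_cancel]
    exact (degreeOf_le_totalDegree P i).trans_lt hn
  · have hx' : ∀ i, ∃ m : ℕ, (m ≠ 0 ∧ m ≤ n) ∧ (m : R) = x i := fun i => by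
      obtain ⟨m, hm, hmx⟩ := Finset.mem_image.mp (hx i)
      rw [Finset.mem_Icc] at hm
      exact ⟨m, ⟨by omega, hm.2⟩, hmx⟩
    choose b hb hbx using hx'
    rw [← funext hbx]
    exact h b (fun i => (hb i).1) fun i => (hb i).2

lemma exists_homogeneousComponent_ne_zero {R σ : Type*} [CommRing R] {F : MvPolynomial σ R}
    (hF : ¬ F.IsHomogeneous F.totalDegree) :
    ∃ k < F.totalDegree, homogeneousComponent k F ≠ 0 := by
  by_contra! h
  apply hF
  have hsum := sum_homogeneousComponent F
  rw [Finset.sum_range_succ, Finset.sum_eq_zero fun k hk => h k (Finset.mem_range.mp hk),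
    zero_add] at hsum
  have hhom := homogeneousComponent_isHomogeneous F.totalDegree F
  rwa [hsum] at hhom

lemma homogeneousComponent_totalDegree_ne_zero {R σ : Type*} [CommRing R] {F : MvPolynomial σ R}
    (hF : F ≠ 0) : homogeneousComponent F.totalDegree F ≠ 0 := by
  obtain ⟨m, hm, hmdeg⟩ := Finset.exists_mem_eq_sup F.support (support_nonempty.mpr hF)
    fun s => s.sum fun _ e => e
  intro h
  have hc := coeff_homogeneousComponent F.totalDegree F m
  rw [h, coeff_zero, if_pos (by rw [totalDegree, hmdeg, Finsupp.degree_apply]; rfl)] at hc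
  exact mem_support_iff.mp hm hc.symm

end

/-- A polynomial with two nonzero coefficients has a nonzero root. -/
lemma Polynomial.exists_ne_zero_aeval_eq_zero {K L : Type*} [Field K] [Field L] [Algebra K L]
    [IsAlgClosed L] {f : Polynomial K} {j k : ℕ} (hjk : j ≠ k) (hj : f.coeff j ≠ 0)
    (hk : f.coeff k ≠ 0) : ∃ t : L, t ≠ 0 ∧ aeval t f = 0 := by
  have hf : f ≠ 0 := fun h => hj (by simp [h])
  obtain ⟨g, hg, hXg⟩ := exists_eq_pow_rootMultiplicity_mul_and_not_dvd f hf 0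
  rw [C_0, sub_zero] at hg hXg
  set n := f.rootMultiplicity 0
  -- If g were constant, f would be a monomial, with only one nonzero coefficient.
  have hdeg : g.degree ≠ 0 := fun h => by
    rw [eq_C_of_degree_eq_zero h, mul_comm] at hg
    rw [hg, coeff_C_mul_X_pow] at hj hk
    exact hjk ((of_not_not fun h => hj (if_neg h)).trans (of_not_not fun h => hk (if_neg h)).symm)
  obtain ⟨t, ht⟩ := IsAlgClosed.exists_aeval_eq_zero L g hdeg
  refine ⟨t, ?_, by rw [hg, map_mul, ht, mul_zero]⟩
  rintro rfl
  rw [← coeff_zero_eq_aeval_zero', map_eq_zero] at ht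
  exact hXg (X_dvd_iff.mpr ht)

/-! ### Degree and height of a point on the line -/

namespace PolyHeight

lemma degOver_mul_natCast_le {K : Type*} [Field K] [NumberField K] [Algebra K Qbar] {ι : Type*}
    {f : Polynomial K} (hf : f ≠ 0) {t : Qbar} (ht : Polynomial.aeval t f = 0) (b : ι → ℕ) :
    degOver K (fun i => t * (b i : Qbar)) ≤ f.natDegree := by
  have hint : IsIntegral K t := isAlgebraic_iff_isIntegral.mp ⟨f, hf, ht⟩
  have hle : IntermediateField.adjoin K (Set.range fun i => t * (b i : Qbar)) ≤
      IntermediateField.adjoin K {t} := by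
    rw [IntermediateField.adjoin_le_iff]
    rintro _ ⟨i, rfl⟩
    exact mul_mem (IntermediateField.mem_adjoin_simple_self K t) (natCast_mem _ _)
  have : FiniteDimensional K (IntermediateField.adjoin K {t}) :=
    IntermediateField.adjoin.finiteDimensional hint
  calc degOver K (fun i => t * (b i : Qbar))
      ≤ Module.finrank K (IntermediateField.adjoin K {t}) :=
        LinearMap.finrank_le_finrank_of_injective
          (f := (IntermediateField.inclusion hle).toLinearMap)
          (IntermediateField.inclusion_injective hle)
    _ = (minpoly K t).natDegree := IntermediateField.adjoin.finrank hint
    _ ≤ f.natDegree := Polynomial.natDegree_le_of_dvd (minpoly.dvd K t ht) hf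

lemma absHeight_mul_natCast_le {ι : Type*} [Fintype ι] [Nonempty ι] {t : Qbar} (ht : t ≠ 0)
    {b : ι → ℕ} {B : ℕ} (hb : ∀ i, b i ≠ 0) (hB : ∀ i, b i ≤ B) :
    absHeight (fun i => t * (b i : Qbar)) ≤ √(Fintype.card ι) * B := by
  set x : ι → Qbar := fun i => t * (b i : Qbar) with hx
  -- Scaling invariance is applied over the coordinate field, so t must lie in it.
  have htx : t ∈ coordField x := by
    obtain ⟨i⟩ := ‹Nonempty ι›
    have hbi : (b i : Qbar) ≠ 0 := Nat.cast_ne_zero.mpr (hb i)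
    have hti : t = x i / (b i : Qbar) := by rw [hx]; exact (mul_div_cancel_right₀ t hbi).symm
    rw [hti]
    exact div_mem (IntermediateField.subset_adjoin ℚ _ ⟨i, rfl⟩) (natCast_mem _ _)
  have h := height_mul_natCast_le (K := coordField x) (t := ⟨t, htx⟩)
    (fun h => ht (congrArg Subtype.val h)) hb hB
  exact h

end PolyHeight

theorem corollary2 (K : Type*) [Field K] [NumberField K] [Algebra K Qbar]
    (N M : ℕ) (hN : 2 ≤ N) (hM : 1 ≤ M)
    (F : MvPolynomial (Fin N) K) (hdeg : F.totalDegree = M) (hinhom : ¬ F.IsHomogeneous M)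
    (he : ∀ i : Fin N, MvPolynomial.eval (Pi.single i (1 : K)) F ≠ 0) :
    ∃ z : Fin N → Qbar,
      PolyHeight.degOver K z ≤ M ∧
      MvPolynomial.aeval z F = 0 ∧
      (∀ i, z i ≠ 0) ∧
      PolyHeight.absHeight z ≤
        PolyHeight.C2 (N + 1) M * PolyHeight.polyHeight F ^ ((1 : ℝ) / (M : ℝ)) := by
  subst hdeg
  have : Nonempty (Fin N) := ⟨⟨0, by omega⟩⟩
  have hF : F ≠ 0 := fun h => hinhom (h ▸ MvPolynomial.isHomogeneous_zero _ _ _)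
  obtain ⟨k, hkM, hk⟩ := exists_homogeneousComponent_ne_zero hinhom
  have htop := homogeneousComponent_totalDegree_ne_zero hF
  -- The product of the two components has degree at most M + k < 2M.
  obtain ⟨b, hb, hbM, hbP⟩ := exists_natCast_eval_ne_zero (n := 2 * F.totalDegree)
    (mul_ne_zero htop hk) (by
      have h1 := (MvPolynomial.homogeneousComponent_isHomogeneous F.totalDegree F).totalDegree_le
      have h2 := (MvPolynomial.homogeneousComponent_isHomogeneous k F).totalDegree_le
      have h3 := MvPolynomial.totalDegree_mul
        (MvPolynomial.homogeneousComponent F.totalDegree F) (MvPolynomial.homogeneousComponent k F)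
      omega)
  rw [map_mul, mul_ne_zero_iff, ← coeff_aeval_C_mul_X, ← coeff_aeval_C_mul_X] at hbP
  set f : Polynomial K :=
    MvPolynomial.aeval (fun i => Polynomial.C (b i : K) * Polynomial.X) F with hfdef
  have hf : f ≠ 0 := fun h => hbP.1 (by rw [h, Polynomial.coeff_zero])
  have hfdeg : f.natDegree ≤ F.totalDegree := Polynomial.natDegree_le_iff_coeff_eq_zero.mpr
    fun n hn => by
      rw [coeff_aeval_C_mul_X, MvPolynomial.homogeneousComponent_eq_zero _ _ hn, map_zero]
  obtain ⟨t, ht, hft⟩ := Polynomial.exists_ne_zero_aeval_eq_zero (L := Qbar) hkM.ne' hbP.1 hbP.2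
  refine ⟨fun i => t * (b i : Qbar), (PolyHeight.degOver_mul_natCast_le hf hft b).trans hfdeg, ?_,
    fun i => mul_ne_zero ht (Nat.cast_ne_zero.mpr (hb i)), ?_⟩
  · rw [hfdef, ← AlgHom.comp_apply, MvPolynomial.comp_aeval] at hft
    rw [← hft]
    simp [mul_comm]
  · calc PolyHeight.absHeight (fun i => t * (b i : Qbar))
        ≤ √(Fintype.card (Fin N)) * (2 * F.totalDegree : ℕ) :=
          PolyHeight.absHeight_mul_natCast_le ht hb hbM
      _ ≤ PolyHeight.C2 (N + 1) F.totalDegree := by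
          rw [Fintype.card_fin]
          exact PolyHeight.sqrt_mul_le_C2 hN hM
      _ ≤ _ := le_mul_of_one_le_right
          ((by positivity : (0 : ℝ) ≤ _).trans (PolyHeight.sqrt_mul_le_C2 hN hM))
          (Real.one_le_rpow (PolyHeight.one_le_polyHeight hF) (by positivity))
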